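/- Let $M$ be a von Neumann algebra with a faithful normal finite trace $\tau$. Let $L^1(M,\tau)$ be the completion of $M$ with respect to the norm $\|x\|_1=\tau(|x|)$, where $|x|=(x^*x)^{1/2}$; let $L^1(M_{sa},\tau)\subseteq L^1(M,\tau)$ be the completion (closure) of the self-adjoint part $M_{sa}$ of $M$ with respect to $\|\cdot\|_1$; and denote again by $\tau$ the continuous linear extension of $\tau$ to $L^1(M,\tau)$. Put $$X=\{x\in L^1(M_{sa},\tau):\ \tau(x)=0\}.$$ For a bounded linear operator $T:L^1(M,\tau)\to L^1(M,\tau)$ with operator norm $\|T\|$, define $$\bar\alpha(T)=\sup_{x\in X,\ x\neq 0}\frac{\|Tx\|_1}{\|x\|_1},\qquad \alpha(T)=\|T\|-\bar\alpha(T),$$ where the supremum is $0$ if $X=\{0\}$; $\alpha(T)$ is called the Dobrushin coefficient of ergodicity of $T$. Theorem 3.1. For every bounded linear operator $T:L^1(M,\tau)\to L^1(M,\tau)$ and every $x\in L^1(M_{sa},\tau)$, $$\|Tx\|_1\le\bar\alpha(T)\,\|x\|_1+\alpha(T)\,|\tau(x)|.$$ -/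

import Mathlib

open scoped ComplexOrder

/-- A faithful normal finite trace on a von Neumann algebra `M`: a positive linear functional `τ`
on `M` (defined on all of `M`, hence finite) that is tracial, faithful and normal. -/
structure FiniteTrace (M : Type*) [CStarAlgebra M] [PartialOrder M] [StarOrderedRing M] where
  /-- the underlying positive linear functional -/
  toPositive : M →ₚ[ℂ] ℂ
  map_mul_comm : ∀ x y : M, toPositive (x * y) = toPositive (y * x)
  faithful : ∀ x : M, 0 ≤ x → toPositive x = 0 → x = 0
  /-- `τ (sup s) = sup τ(s)` for every upward directed set `s` of positive elements which has a
  supremum in `M`. -/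
  normal : ∀ (s : Set M) (a : M), s.Nonempty → DirectedOn (· ≤ ·) s → (∀ x ∈ s, 0 ≤ x) →
    IsLUB s a → IsLUB (toPositive '' s) (toPositive a)

namespace FiniteTrace

variable {M : Type*} [CStarAlgebra M] [PartialOrder M] [StarOrderedRing M] (τ : FiniteTrace M)

/-- The trace norm `‖x‖₁ = τ(|x|)` of `x ∈ M`, where `|x| = (x* x)^(1/2)`. -/
noncomputable def traceNorm (x : M) : ℝ := (τ.toPositive (CFC.abs x)).re

theorem coe_traceNorm (x : M) : (τ.traceNorm x : ℂ) = τ.toPositive (CFC.abs x) := by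
  have h : 0 ≤ τ.toPositive (CFC.abs x) := τ.toPositive.map_nonneg (CFC.abs_nonneg x)
  rw [Complex.nonneg_iff] at h
  exact Complex.ext rfl (by simpa [traceNorm] using h.2)

theorem traceNorm_nonneg (x : M) : 0 ≤ τ.traceNorm x := by
  have h : 0 ≤ τ.toPositive (CFC.abs x) := τ.toPositive.map_nonneg (CFC.abs_nonneg x)
  exact (Complex.nonneg_iff.1 h).1

theorem eq_zero_of_traceNorm (x : M) (h : τ.traceNorm x = 0) : x = 0 := by
  rw [← CFC.abs_eq_zero_iff]
  refine τ.faithful _ (CFC.abs_nonneg x) ?_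
  rw [← coe_traceNorm, h, Complex.ofReal_zero]

theorem traceNorm_smul (c : ℂ) (x : M) : τ.traceNorm (c • x) = ‖c‖ * τ.traceNorm x := by
  rw [traceNorm, CFC.abs_smul, ← Complex.coe_smul, map_smul]
  simp [traceNorm]

/-- An approximate polar decomposition in a unital C*-algebra. -/
theorem exists_approx_polar (x : M) {ε : ℝ} (hε : 0 < ε) :
    ∃ v : M, ‖v‖ ≤ 1 ∧ ‖x - v * CFC.abs x‖ ≤ ε ∧ ‖CFC.abs x - star v * x‖ ≤ ε := by
  set b := CFC.abs x with hb
  have hb0 : 0 ≤ b := CFC.abs_nonneg x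
  have hbs : IsSelfAdjoint b := .of_nonneg hb0
  have hsp : ∀ t ∈ spectrum ℝ b, 0 ≤ t := fun t ht => spectrum_nonneg_of_nonneg hb0 ht
  have hbb : star x * x = b * b := (CFC.abs_mul_abs x).symm
  have hidb : cfc (fun t : ℝ => t) b = b := cfc_id' ℝ b
  have hcont : ContinuousOn (fun t : ℝ => (t + ε)⁻¹) (spectrum ℝ b) := by
    refine ContinuousOn.inv₀ (by fun_prop) fun t ht => ?_
    have := hsp t ht
    positivity
  set r := cfc (fun t : ℝ => (t + ε)⁻¹) b with hr
  have hrs : star r = r := (cfc_predicate (fun t : ℝ => (t + ε)⁻¹) b : IsSelfAdjoint r)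
  have hrb : r * b = cfc (fun t : ℝ => (t + ε)⁻¹ * t) b := by
    conv_lhs => rw [← hidb]
    rw [hr, hidb]
    conv_lhs => rw [← hidb]
    rw [hidb, cfc_mul (fun t : ℝ => (t + ε)⁻¹) (fun t : ℝ => t) b hcont (by fun_prop), hidb]
  have hbr : b * r = r * b := by
    rw [hrb]
    simp_rw [mul_comm _ (_ : ℝ)]
    rw [cfc_mul (fun t : ℝ => t) (fun t : ℝ => (t + ε)⁻¹) b (by fun_prop) hcont, hidb]
  have hc2 : ContinuousOn (fun t : ℝ => (t + ε)⁻¹ * t) (spectrum ℝ b) :=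
    hcont.mul (by fun_prop)
  have hrb1 : ‖r * b‖ ≤ 1 := by
    rw [hrb]
    refine norm_cfc_le zero_le_one fun t ht => ?_
    have := hsp t ht
    rw [Real.norm_of_nonneg (by positivity), inv_mul_le_iff₀ (by positivity)]
    linarith
  have hd : ‖b - r * b * b‖ ≤ ε := by
    have : b - r * b * b = cfc (fun t : ℝ => t - (t + ε)⁻¹ * t * t) b := by
      rw [cfc_sub (fun t : ℝ => t) (fun t : ℝ => (t + ε)⁻¹ * t * t) b (by fun_prop)
        (hc2.mul (by fun_prop)), cfc_mul (fun t : ℝ => (t + ε)⁻¹ * t) (fun t : ℝ => t) b hc2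
        (by fun_prop), hidb, ← hrb]
    rw [this]
    refine norm_cfc_le hε.le fun t ht => ?_
    have h0 := hsp t ht
    have : t - (t + ε)⁻¹ * t * t = ε * ((t + ε)⁻¹ * t) := by
      have : t + ε ≠ 0 := by positivity
      field_simp
      ring
    rw [this, Real.norm_of_nonneg (by positivity)]
    have : (t + ε)⁻¹ * t ≤ 1 := by
      rw [inv_mul_le_iff₀ (by positivity)]
      linarith
    nlinarith
  refine ⟨x * r, ?_, ?_, ?_⟩
  · have h : ‖x * r‖ * ‖x * r‖ = ‖r * b‖ * ‖r * b‖ := by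
      rw [← CStarRing.norm_star_mul_self, ← CStarRing.norm_self_mul_star]
      congr 1
      rw [star_mul, star_mul, hrs, hbs.star_eq,
        show r * star x * (x * r) = r * (star x * x) * r by noncomm_ring, hbb]
      noncomm_ring
    nlinarith [norm_nonneg (x * r), norm_nonneg (r * b)]
  · have h : ‖x - x * r * b‖ * ‖x - x * r * b‖ = ‖b - r * b * b‖ * ‖b - r * b * b‖ := by
      rw [← CStarRing.norm_star_mul_self, ← CStarRing.norm_star_mul_self]
      congr 1
      have e1 : star (x - x * r * b) = star x - b * r * star x := by
        simp [star_mul, hrs, hbs.star_eq, mul_assoc]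
      have e2 : star (b - r * b * b) = b - b * b * r := by
        simp [star_mul, hrs, hbs.star_eq, mul_assoc]
      rw [e1, e2]
      have e3 : (star x - b * r * star x) * (x - x * r * b)
          = (1 - b * r) * (star x * x) * (1 - r * b) := by noncomm_ring
      rw [e3, hbb]
      have e4 : b * b * r = b * r * b := by rw [mul_assoc, hbr, ← mul_assoc, hbr]
      have e5 : r * b * b = b * (r * b) := by rw [← mul_assoc, hbr]
      rw [e4, e5]
      noncomm_ring
    nlinarith [norm_nonneg (x - x * r * b), norm_nonneg (b - r * b * b)]
  · rw [star_mul, hrs, mul_assoc, hbb, ← mul_assoc]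
    exact hd

/-- The trace is bounded for the operator norm. -/
theorem exists_bound : ∃ C : ℝ, 0 ≤ C ∧ ∀ a : M, ‖τ.toPositive a‖ ≤ C * ‖a‖ := by
  obtain ⟨C, hC⟩ := τ.toPositive.exists_norm_apply_le
  exact ⟨C, C.2, hC⟩

theorem norm_apply_mul_le_of_nonneg (c b : M) (hc : ‖c‖ ≤ 1) (hb : 0 ≤ b) :
    ‖τ.toPositive (c * b)‖ ≤ (τ.toPositive b).re := by
  set s := CFC.sqrt b with hs
  have hss : s * s = b := CFC.sqrt_mul_sqrt_self b hb
  have hsa : star s = s := (IsSelfAdjoint.of_nonneg (CFC.sqrt_nonneg b)).star_eq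
  have key := norm_inner_le_norm (𝕜 := ℂ) (τ.toPositive.toPreGNS (star c * s))
    (τ.toPositive.toPreGNS s)
  have hsym (a : M) : τ.toPositive.ofPreGNS (τ.toPositive.toPreGNS a) = a := rfl
  rw [PositiveLinearMap.preGNS_inner_def, PositiveLinearMap.preGNS_norm_def,
    PositiveLinearMap.preGNS_norm_def] at key
  simp only [hsym, star_mul, star_star, hsa, hss] at key
  have e : τ.toPositive (c * b) = τ.toPositive (s * c * s) := by
    rw [← hss, ← mul_assoc, τ.map_mul_comm, ← mul_assoc]
  have hnn : 0 ≤ (τ.toPositive b).re := (Complex.nonneg_iff.1 (τ.toPositive.map_nonneg hb)).1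
  have hle : (τ.toPositive (s * c * (star c * s))).re ≤ (τ.toPositive b).re := by
    have h1 : c * star c ≤ 1 := by
      rw [← CStarAlgebra.norm_le_one_iff_of_nonneg _ (mul_star_self_nonneg c),
        CStarRing.norm_self_mul_star]
      nlinarith [norm_nonneg c]
    have h2 : s * c * (star c * s) ≤ b := by
      have := star_left_conjugate_le_conjugate h1 s
      rw [hsa, mul_one, hss] at this
      convert this using 1
      noncomm_ring
    exact (Complex.le_def.1 (OrderHomClass.mono τ.toPositive h2)).1
  rw [e]
  refine key.trans ?_
  calc √(τ.toPositive (s * c * (star c * s))).re * √(τ.toPositive b).re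
      ≤ √(τ.toPositive b).re * √(τ.toPositive b).re := by gcongr
    _ = (τ.toPositive b).re := Real.mul_self_sqrt hnn

theorem norm_apply_mul_le (y x : M) (hy : ‖y‖ ≤ 1) :
    ‖τ.toPositive (y * x)‖ ≤ τ.traceNorm x := by
  obtain ⟨C, hC0, hC⟩ := τ.exists_bound
  refine le_of_forall_pos_le_add fun δ hδ => ?_
  obtain ⟨v, hv, h1, -⟩ := exists_approx_polar x (ε := δ / (C + 1)) (by positivity)
  have e : y * x = y * v * CFC.abs x + y * (x - v * CFC.abs x) := by noncomm_ring
  rw [e, map_add]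
  refine (norm_add_le _ _).trans (add_le_add ?_ ?_)
  · refine τ.norm_apply_mul_le_of_nonneg _ _ ?_ (CFC.abs_nonneg x)
    exact (norm_mul_le _ _).trans (mul_le_one₀ hy (norm_nonneg _) hv)
  · refine (hC _).trans ?_
    have h2 : ‖y * (x - v * CFC.abs x)‖ ≤ δ / (C + 1) :=
      (norm_mul_le _ _).trans (by nlinarith [norm_nonneg (x - v * CFC.abs x)])
    calc C * ‖y * (x - v * CFC.abs x)‖ ≤ (C + 1) * (δ / (C + 1)) := by
          gcongr; linarith
      _ = δ := by field_simp

theorem norm_apply_le (x : M) : ‖τ.toPositive x‖ ≤ τ.traceNorm x := by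
  have h1 : ‖(1 : M)‖ ≤ 1 := by
    rcases subsingleton_or_nontrivial M with h | h
    · simp [Subsingleton.elim (1 : M) 0]
    · simp
  simpa using τ.norm_apply_mul_le 1 x h1

theorem traceNorm_add_le (x y : M) : τ.traceNorm (x + y) ≤ τ.traceNorm x + τ.traceNorm y := by
  obtain ⟨C, hC0, hC⟩ := τ.exists_bound
  refine le_of_forall_pos_le_add fun δ hδ => ?_
  obtain ⟨v, hv, -, h1⟩ := exists_approx_polar (x + y) (ε := δ / (C + 1)) (by positivity)
  have hv' : ‖star v‖ ≤ 1 := by rwa [norm_star]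
  have e : τ.toPositive (CFC.abs (x + y)) = τ.toPositive (star v * x) + τ.toPositive (star v * y)
      + τ.toPositive (CFC.abs (x + y) - star v * (x + y)) := by
    rw [← map_add, ← map_add]
    congr 1
    noncomm_ring
  have h2 : τ.traceNorm (x + y) = ‖τ.toPositive (CFC.abs (x + y))‖ := by
    rw [← coe_traceNorm, Complex.norm_of_nonneg (τ.traceNorm_nonneg _)]
  rw [h2, e]
  refine (norm_add₃_le).trans ?_
  have h3 : ‖τ.toPositive (CFC.abs (x + y) - star v * (x + y))‖ ≤ δ := by
    refine (hC _).trans ?_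
    calc C * ‖CFC.abs (x + y) - star v * (x + y)‖ ≤ (C + 1) * (δ / (C + 1)) := by
          gcongr; linarith
      _ = δ := by field_simp
  exact add_le_add (add_le_add (τ.norm_apply_mul_le _ _ hv') (τ.norm_apply_mul_le _ _ hv')) h3

set_option linter.unusedVariables false in
/-- The vector space `M`, to be equipped with the norm `‖·‖₁` (a type synonym of `M`). -/
@[nolint unusedArguments]
def PreL1 (τ : FiniteTrace M) : Type _ := M

noncomputable instance : AddCommGroup τ.PreL1 := inferInstanceAs (AddCommGroup M)

noncomputable instance : Module ℂ τ.PreL1 := inferInstanceAs (Module ℂ M)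

/-- The identity map from `M` to `M` with the norm `‖·‖₁`. -/
noncomputable def toPreL1 : M ≃ₗ[ℂ] τ.PreL1 := LinearEquiv.refl ℂ M

theorem normedSpaceCore : letI : Norm τ.PreL1 := ⟨fun x => τ.traceNorm (τ.toPreL1.symm x)⟩
    NormedSpace.Core ℂ τ.PreL1 :=
  letI : Norm τ.PreL1 := ⟨fun x => τ.traceNorm (τ.toPreL1.symm x)⟩
  { norm_nonneg := fun x => τ.traceNorm_nonneg _
    norm_smul := fun c x => τ.traceNorm_smul c _
    norm_triangle := fun x y => τ.traceNorm_add_le _ _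
    norm_eq_zero_iff := fun x => ⟨fun h => τ.eq_zero_of_traceNorm _ h, fun h => by
      subst h
      change τ.traceNorm 0 = 0
      simp [traceNorm]⟩ }

noncomputable instance : NormedAddCommGroup τ.PreL1 :=
  letI : Norm τ.PreL1 := ⟨fun x => τ.traceNorm (τ.toPreL1.symm x)⟩
  NormedAddCommGroup.ofCore τ.normedSpaceCore

noncomputable instance : NormedSpace ℂ τ.PreL1 :=
  letI : Norm τ.PreL1 := ⟨fun x => τ.traceNorm (τ.toPreL1.symm x)⟩
  NormedSpace.ofCore τ.normedSpaceCore

theorem norm_toPreL1 (x : M) : ‖τ.toPreL1 x‖ = τ.traceNorm x := rfl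

/-- The space `L¹(M, τ)`: the completion of `M` with respect to `‖x‖₁ = τ(|x|)`. -/
abbrev L1 (τ : FiniteTrace M) : Type _ := UniformSpace.Completion τ.PreL1

/-- The canonical embedding of `M` into `L¹(M, τ)`. -/
noncomputable def toL1 : M →ₗ[ℂ] τ.L1 :=
  (UniformSpace.Completion.toComplL : τ.PreL1 →L[ℂ] τ.L1).toLinearMap ∘ₗ τ.toPreL1.toLinearMap

theorem norm_toL1 (x : M) : ‖τ.toL1 x‖ = τ.traceNorm x :=
  UniformSpace.Completion.norm_coe (τ.toPreL1 x)

theorem denseRange_toL1 : DenseRange τ.toL1 :=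
  UniformSpace.Completion.denseRange_coe.comp τ.toPreL1.surjective.denseRange
    (UniformSpace.Completion.continuous_coe _)

/-- The trace on `L¹(M, τ)`: the unique `‖·‖₁`-continuous linear extension of `τ`. -/
noncomputable def traceL1 : τ.L1 →L[ℂ] ℂ :=
  τ.toPositive.toLinearMap.extendOfNorm τ.toL1

theorem traceL1_toL1 (x : M) : τ.traceL1 (τ.toL1 x) = τ.toPositive x :=
  LinearMap.extendOfNorm_eq τ.denseRange_toL1
    ⟨1, fun x => by rw [one_mul, norm_toL1]; exact τ.norm_apply_le x⟩ x

/-- The self-adjoint part `L¹(M_sa, τ)` of `L¹(M, τ)`: the completion of the self-adjoint part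
`M_sa` of `M` with respect to `‖·‖₁`, realized as a closure inside `L¹(M, τ)`. -/
def selfAdjointL1 : Set τ.L1 := closure (τ.toL1 '' {x : M | IsSelfAdjoint x})

/-- `X`, the set of self-adjoint elements of `L¹(M, τ)` of trace zero. -/
def traceZero : Set τ.L1 := {x | x ∈ τ.selfAdjointL1 ∧ τ.traceL1 x = 0}

variable {τ}

/-- `ᾱ(T)`, the supremum of `‖T x‖₁ / ‖x‖₁` over nonzero self-adjoint `x` of trace zero (it is `0`
when there is no such `x`). -/
noncomputable def alphaBar (T : τ.L1 →L[ℂ] τ.L1) : ℝ :=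
  sSup {c : ℝ | ∃ x ∈ τ.traceZero, x ≠ 0 ∧ c = ‖T x‖ / ‖x‖}

/-- The supremum defining `ᾱ(T)` is over a bounded set. -/
theorem bddAbove_alphaBar (T : τ.L1 →L[ℂ] τ.L1) :
    BddAbove {c : ℝ | ∃ x ∈ τ.traceZero, x ≠ 0 ∧ c = ‖T x‖ / ‖x‖} := by
  refine ⟨‖T‖, ?_⟩
  rintro c ⟨x, -, -, rfl⟩
  exact T.ratio_le_opNorm x

/-- The Dobrushin coefficient of ergodicity `α(T) = ‖T‖ - ᾱ(T)`. -/
noncomputable def dobrushin (T : τ.L1 →L[ℂ] τ.L1) : ℝ := ‖T‖ - alphaBar T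

end FiniteTrace

namespace FiniteTrace

variable {M : Type*} [CStarAlgebra M] [PartialOrder M] [StarOrderedRing M] {τ : FiniteTrace M}

/-! Both sides are continuous in `x`, so it suffices to treat self-adjoint `a : M`. Let `p` and `q`
be the traces of `a⁺` and `a⁻`, so that `‖a‖₁ = p + q` and `τ(a) = p - q`; replacing `a` by `-a`,
assume `q ≤ p`. Shrink `a⁺` to a multiple `u` of trace `q`. Then `a = (a⁺ - u) + (u - a⁻)`: the
first summand is positive of norm `p - q` and is controlled by `‖T‖`, the second has trace zero and
norm at most `2q` and is controlled by `ᾱ(T)`. The resulting bound `‖T‖(p - q) + 2q ᾱ(T)` is exactly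
`ᾱ(T)(p + q) + α(T)(p - q)`. The splitting is `norm_apply_toL1_sub_le`. -/

theorem norm_apply_le_alphaBar (T : τ.L1 →L[ℂ] τ.L1) {z : τ.L1} (hz : z ∈ τ.traceZero) :
    ‖T z‖ ≤ alphaBar T * ‖z‖ := by
  rcases eq_or_ne z 0 with rfl | h0
  · simp
  · rw [← div_le_iff₀ (norm_pos_iff.2 h0)]
    exact le_csSup (bddAbove_alphaBar T) ⟨z, hz, h0, rfl⟩

theorem toPositive_eq_traceNorm_of_nonneg {a : M} (ha : 0 ≤ a) :
    τ.toPositive a = τ.traceNorm a := by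
  rw [coe_traceNorm, CFC.abs_of_nonneg a ha]

/-- Holds because `|a| = a⁺ + a⁻`. An arbitrary splitting of `a` into a difference of positive
elements would give only `≤`. -/
theorem traceNorm_eq_posPart_add_negPart {a : M} (ha : IsSelfAdjoint a) :
    τ.traceNorm a = τ.traceNorm a⁺ + τ.traceNorm a⁻ := by
  have h : τ.toPositive (CFC.abs a) = τ.toPositive a⁺ + τ.toPositive a⁻ := by
    rw [← map_add, CFC.posPart_add_negPart a ha]
  rw [← coe_traceNorm, toPositive_eq_traceNorm_of_nonneg (CFC.posPart_nonneg a),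
    toPositive_eq_traceNorm_of_nonneg (CFC.negPart_nonneg a)] at h
  exact_mod_cast h

theorem toPositive_eq_posPart_sub_negPart {a : M} (ha : IsSelfAdjoint a) :
    τ.toPositive a = ((τ.traceNorm a⁺ - τ.traceNorm a⁻ : ℝ) : ℂ) := by
  rw [Complex.ofReal_sub, ← toPositive_eq_traceNorm_of_nonneg (CFC.posPart_nonneg a),
    ← toPositive_eq_traceNorm_of_nonneg (CFC.negPart_nonneg a), ← map_sub,
    CFC.posPart_sub_negPart a ha]

/-- The Dobrushin inequality for a difference of positive elements, the first of which has the
larger trace. -/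
theorem norm_apply_toL1_sub_le (T : τ.L1 →L[ℂ] τ.L1) {b c : M} (hb : 0 ≤ b) (hc : 0 ≤ c)
    (h : τ.traceNorm c ≤ τ.traceNorm b) :
    ‖T (τ.toL1 (b - c))‖ ≤ alphaBar T * (τ.traceNorm b + τ.traceNorm c) +
      dobrushin T * (τ.traceNorm b - τ.traceNorm c) := by
  set p := τ.traceNorm b with hp
  set q := τ.traceNorm c with hq
  have hq0 : 0 ≤ q := τ.traceNorm_nonneg c
  -- The scaling factor is `q / p`; if `p = 0` then `q = 0` as well, and `t = 0` serves.
  obtain ⟨t, ht0, ht1, htq⟩ : ∃ t : ℝ, 0 ≤ t ∧ t ≤ 1 ∧ t * p = q := by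
    rcases (hq0.trans h).eq_or_lt with h0 | h0
    · exact ⟨0, le_rfl, zero_le_one, by linarith⟩
    · exact ⟨q / p, by positivity, (div_le_one h0).2 h, by field_simp⟩
  -- The sign is needed to replace `‖u - c‖₁` by its upper bound `2q` below; it holds also when the
  -- supremum is over the empty set.
  have hα : 0 ≤ alphaBar T := Real.sSup_nonneg fun r ⟨z, _, _, hr⟩ => hr ▸ by positivity
  set u : M := (t : ℂ) • b with hu
  have hnu : τ.traceNorm u = q := by
    rw [hu, traceNorm_smul, Complex.norm_of_nonneg ht0, htq]
  have hz : τ.toL1 (u - c) ∈ τ.traceZero := by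
    refine ⟨subset_closure ⟨_, ?_, rfl⟩, ?_⟩
    · rw [hu, Complex.coe_smul]
      exact (IsSelfAdjoint.of_nonneg (smul_nonneg ht0 hb)).sub (.of_nonneg hc)
    · rw [traceL1_toL1, map_sub, hu, map_smul, toPositive_eq_traceNorm_of_nonneg hb,
        toPositive_eq_traceNorm_of_nonneg hc, smul_eq_mul, ← hp, ← hq, ← htq]
      simp
  have hnz : ‖τ.toL1 (u - c)‖ ≤ 2 * q := by
    rw [map_sub]
    refine (norm_sub_le _ _).trans ?_
    rw [norm_toL1, norm_toL1, hnu]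
    linarith
  -- An exact value, since `b - u` is a nonnegative multiple of `b`.
  have hny : ‖τ.toL1 (b - u)‖ = p - q := by
    have e : b - u = ((1 - t : ℝ) : ℂ) • b := by
      rw [hu, Complex.ofReal_sub, Complex.ofReal_one, sub_smul, one_smul]
    rw [e, norm_toL1, traceNorm_smul, Complex.norm_of_nonneg (by linarith), ← hp]
    linarith
  calc ‖T (τ.toL1 (b - c))‖ = ‖T (τ.toL1 (b - u)) + T (τ.toL1 (u - c))‖ := by
        rw [← map_add, ← map_add, sub_add_sub_cancel]
    _ ≤ ‖T‖ * (p - q) + alphaBar T * (2 * q) := by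
        refine (norm_add_le _ _).trans (add_le_add ?_ ?_)
        · exact hny ▸ T.le_opNorm _
        · exact (norm_apply_le_alphaBar T hz).trans (by gcongr)
    -- Write `‖T‖ = ᾱ(T) + α(T)` and `(p - q) + 2q = p + q`.
    _ = alphaBar T * (p + q) + dobrushin T * (p - q) := by
        rw [dobrushin]
        ring

theorem norm_apply_toL1_le (T : τ.L1 →L[ℂ] τ.L1) {a : M} (ha : IsSelfAdjoint a) :
    ‖T (τ.toL1 a)‖ ≤ alphaBar T * ‖τ.toL1 a‖ + dobrushin T * ‖τ.traceL1 (τ.toL1 a)‖ := by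
  rw [norm_toL1, traceL1_toL1, toPositive_eq_posPart_sub_negPart ha, Complex.norm_real,
    traceNorm_eq_posPart_add_negPart ha, Real.norm_eq_abs]
  have hp := CFC.posPart_nonneg a
  have hn := CFC.negPart_nonneg a
  rcases le_total (τ.traceNorm a⁻) (τ.traceNorm a⁺) with h | h
  · rw [abs_of_nonneg (sub_nonneg.2 h)]
    simpa only [CFC.posPart_sub_negPart a ha] using norm_apply_toL1_sub_le T hp hn h
  -- The negative part dominates: pass to `-a`, which exchanges `a⁺` and `a⁻` and leaves both sides
  -- unchanged.
  · rw [abs_sub_comm, abs_of_nonneg (sub_nonneg.2 h), add_comm (τ.traceNorm a⁺), ← norm_neg,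
      ← map_neg, ← map_neg]
    have e : a⁻ - a⁺ = -a := by rw [← neg_sub, CFC.posPart_sub_negPart a ha]
    simpa only [e] using norm_apply_toL1_sub_le T hn hp h

end FiniteTrace

theorem theorem3p1 {M : Type*} [CStarAlgebra M] [WStarAlgebra M] [PartialOrder M]
    [StarOrderedRing M] (τ : FiniteTrace M) (T : τ.L1 →L[ℂ] τ.L1) (x : τ.L1)
    (hx : x ∈ τ.selfAdjointL1) :
    ‖T x‖ ≤ FiniteTrace.alphaBar T * ‖x‖ + FiniteTrace.dobrushin T * ‖τ.traceL1 x‖ := by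
  -- The inequality cuts out a closed set, so it passes from the image of `M_sa` to its closure.
  refine closure_minimal (t := {x | ‖T x‖ ≤ FiniteTrace.alphaBar T * ‖x‖ +
    FiniteTrace.dobrushin T * ‖τ.traceL1 x‖}) ?_ (isClosed_le (by fun_prop) (by fun_prop)) hx
  rintro _ ⟨a, ha, rfl⟩
  exact FiniteTrace.norm_apply_toL1_le T ha
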